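/- Let $\Gamma$ be a compact connected metric graph, i.e. the metric space (with the path metric) underlying a finite connected multigraph $G$ (loops and multiple edges allowed) each of whose edges is given a positive real length, and suppose that its genus $g$, i.e. its first Betti number $|E(G)|-|V(G)|+1$, satisfies $g\ge 2$. A divisor on $\Gamma$ is an element $D=\sum_{v\in\Gamma}D(v)[v]$ of the free abelian group on the points of $\Gamma$, and $\deg D=\sum_v D(v)$. For a closed set $A\subseteq\Gamma$ and $v\in\partial A$, let $\operatorname{outdeg}_A(v)$ be the maximum number of internally disjoint segments (arcs) of $\Gamma\setminus A$ with open end $v$. For a point $v_0\in\Gamma$, a divisor $D$ is called $v_0$-reduced if $D(v)\ge 0$ for all $v\ne v_0$ and every non-empty compact set $A\subseteq\Gamma\setminus\{v_0\}$ has a boundary point $v\in\partial A$ with $D(v)<\operatorname{outdeg}_A(v)$. **Theorem.** Let $v_0\in\Gamma$ and let $D$ be a $v_0$-reduced divisor on $\Gamma$. If $\deg D-D(v_0)\le g-1$, then there is a point $w\in\Gamma\setminus\{v_0\}$ such that $D+[w]$ is a $v_0$-reduced divisor. -/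

import Mathlib

universe u v

namespace MetricGraph

/-- An edge-weighted graph on the vertex set `V` and the edge set `E`: a connected multigraph
(loops and multiple edges are allowed; finiteness of `V` and `E` is assumed separately) together
with a positive length for every edge. The choice of which end of an edge is `src` and which is
`tgt` only serves to parametrize the edge. -/
structure EdgeWeightedGraph (V : Type u) (E : Type v) where
  src : E → V
  tgt : E → V
  len : E → ℝ
  len_pos : ∀ e, 0 < len e
  nonempty : Nonempty V
  connected : ∀ a b : V, Relation.EqvGen (fun p q => ∃ e, src e = p ∧ tgt e = q) a b

namespace EdgeWeightedGraph

variable {V : Type u} {E : Type v}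

/-- The cellular boundary map `C₁ = ℚ^(E) → C₀ = ℚ^(V)` of the graph, `e ↦ tgt e - src e`. -/
noncomputable def boundary (G : EdgeWeightedGraph V E) : (E →₀ ℚ) →ₗ[ℚ] (V →₀ ℚ) :=
  Finsupp.linearCombination ℚ
    (fun e => Finsupp.single (G.tgt e) (1 : ℚ) - Finsupp.single (G.src e) (1 : ℚ))

/-- The genus: the first Betti number, i.e. the dimension of `H₁ = ker (C₁ → C₀)`
(there are no cells of dimension 2). -/
noncomputable def genus (G : EdgeWeightedGraph V E) : ℕ :=
  Module.finrank ℚ (LinearMap.ker G.boundary)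

/-- The points of the metric graph with model `G`: the vertices, and for every edge `e` the points
of the open interval `(0, len e)`. -/
inductive Point (G : EdgeWeightedGraph V E) : Type (max u v)
  | vertex (a : V) : Point G
  | inner (e : E) (t : ℝ) (h₀ : 0 < t) (h₁ : t < G.len e) : Point G

/-- The parametrization `[0, len e] → Γ` of the edge `e`, from its source to its target
(extended by constants to all real parameters). -/
noncomputable def edgePoint (G : EdgeWeightedGraph V E) (e : E) (t : ℝ) : G.Point :=
  if h₀ : 0 < t then
    if h₁ : t < G.len e then Point.inner e t h₀ h₁ else Point.vertex (G.tgt e)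
  else Point.vertex (G.src e)

/-- `PathLength G x y L`: there is a path from `x` to `y` of total length `L` that consists of
finitely many pieces, each running monotonically inside one closed edge. -/
inductive PathLength (G : EdgeWeightedGraph V E) : G.Point → G.Point → ℝ → Prop
  | nil (x : G.Point) : PathLength G x x 0
  | cons (e : E) (s t : ℝ) (hs : s ∈ Set.Icc 0 (G.len e)) (ht : t ∈ Set.Icc 0 (G.len e))
      {y : G.Point} {L : ℝ} (h : PathLength G (G.edgePoint e t) y L) :
      PathLength G (G.edgePoint e s) y (|s - t| + L)

variable (G : EdgeWeightedGraph V E)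

theorem edgePoint_zero (e : E) : G.edgePoint e 0 = Point.vertex (G.src e) := by
  simp [edgePoint]

theorem edgePoint_len (e : E) : G.edgePoint e (G.len e) = Point.vertex (G.tgt e) := by
  simp [edgePoint, G.len_pos e]

theorem edgePoint_inner (e : E) (t : ℝ) (h₀ : 0 < t) (h₁ : t < G.len e) :
    G.edgePoint e t = Point.inner e t h₀ h₁ := by
  simp [edgePoint, h₀, h₁]

variable {G}

theorem PathLength.nonneg {x y : G.Point} {L : ℝ} (h : G.PathLength x y L) : 0 ≤ L := by
  induction h with
  | nil x => exact le_rfl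
  | cons e s t hs ht h ih => positivity

theorem PathLength.append {x y z : G.Point} {L M : ℝ} (h : G.PathLength x y L)
    (h' : G.PathLength y z M) : G.PathLength x z (L + M) := by
  induction h with
  | nil x => simpa using h'
  | cons e s t hs ht h ih =>
    rw [add_assoc]
    exact PathLength.cons e s t hs ht (ih h')

theorem PathLength.reverse {x y : G.Point} {L : ℝ} (h : G.PathLength x y L) :
    G.PathLength y x L := by
  induction h with
  | nil x => exact PathLength.nil x
  | cons e s t hs ht h ih =>
    have h1 := ih.append (PathLength.cons e t s ht hs (PathLength.nil _))
    rwa [add_zero, abs_sub_comm, add_comm] at h1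

variable (G)

theorem exists_pathLength_vertex (a b : V) :
    ∃ L, G.PathLength (Point.vertex a) (Point.vertex b) L := by
  induction G.connected a b with
  | rel p q h =>
    obtain ⟨e, rfl, rfl⟩ := h
    have h1 := PathLength.cons (G := G) e 0 (G.len e) ⟨le_rfl, (G.len_pos e).le⟩
      ⟨(G.len_pos e).le, le_rfl⟩ (PathLength.nil _)
    rw [edgePoint_zero, edgePoint_len] at h1
    exact ⟨_, h1⟩
  | refl p => exact ⟨0, PathLength.nil _⟩
  | symm p q _ ih => exact ⟨_, ih.choose_spec.reverse⟩
  | trans p q r _ _ ih1 ih2 => exact ⟨_, ih1.choose_spec.append ih2.choose_spec⟩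

theorem exists_pathLength (x y : G.Point) : ∃ L, G.PathLength x y L := by
  have key : ∀ x : G.Point, ∃ (a : V) (L : ℝ), G.PathLength x (Point.vertex a) L := by
    rintro (a | ⟨e, t, h₀, h₁⟩)
    · exact ⟨a, 0, PathLength.nil _⟩
    · have h1 := PathLength.cons (G := G) e t 0 ⟨h₀.le, h₁.le⟩ ⟨le_rfl, (G.len_pos e).le⟩
        (PathLength.nil _)
      rw [edgePoint_zero, edgePoint_inner G e t h₀ h₁] at h1
      exact ⟨_, _, h1⟩
  obtain ⟨a, L, hL⟩ := key x
  obtain ⟨b, M, hM⟩ := key y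
  obtain ⟨N, hN⟩ := G.exists_pathLength_vertex a b
  exact ⟨_, (hL.append hN).append hM.reverse⟩

/-- The path metric: the infimum of the lengths of paths from `x` to `y`. -/
noncomputable instance instDist : Dist G.Point where
  dist x y := sInf {L | G.PathLength x y L}

theorem dist_def (x y : G.Point) : dist x y = sInf {L | G.PathLength x y L} := rfl

variable {G}

theorem PathLength.dist_le {x y : G.Point} {L : ℝ} (h : G.PathLength x y L) : dist x y ≤ L :=
  csInf_le ⟨0, fun _ hM => PathLength.nonneg hM⟩ h

theorem le_dist {x y : G.Point} {c : ℝ} (h : ∀ L, G.PathLength x y L → c ≤ L) : c ≤ dist x y :=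
  le_csInf (G.exists_pathLength x y) h

/-- A function that is 1-Lipschitz along every edge is 1-Lipschitz. -/
theorem sub_le_dist (f : G.Point → ℝ)
    (hf : ∀ e, ∀ s ∈ Set.Icc 0 (G.len e), ∀ t ∈ Set.Icc 0 (G.len e),
      f (G.edgePoint e s) - f (G.edgePoint e t) ≤ |s - t|) (x y : G.Point) :
    f x - f y ≤ dist x y := by
  refine le_dist fun L h => ?_
  induction h with
  | nil x => simp
  | cons e s t hs ht h ih => linarith [hf e s hs t ht]

theorem dist_inner_pos {e : E} {s : ℝ} {h₀ : 0 < s} {h₁ : s < G.len e} {y : G.Point}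
    (hy : y ≠ Point.inner e s h₀ h₁) : 0 < dist (Point.inner e s h₀ h₁) y := by
  classical
  set r : ℝ := min s (G.len e - s) with hr
  have hr0 : 0 < r := lt_min h₀ (by linarith)
  let f : G.Point → ℝ := fun z => match z with
    | Point.vertex _ => 0
    | Point.inner e' t _ _ => if e' = e then max 0 (r - |t - s|) else 0
  have hf : ∀ e' t, t ∈ Set.Icc 0 (G.len e') →
      f (G.edgePoint e' t) = if e' = e then max 0 (r - |t - s|) else 0 := by
    intro e' t ht
    unfold edgePoint
    split_ifs with a b c c c
    · subst c; simp [f]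
    · simp [f, c]
    · subst c
      have : r - |t - s| ≤ 0 := by
        have := min_le_right s (G.len e' - s)
        have := le_abs_self (t - s)
        linarith
      simp [f, this]
    · simp [f]
    · have : r - |t - s| ≤ 0 := by
        have := min_le_left s (G.len e - s)
        have := neg_abs_le (t - s)
        linarith
      simp [f, this]
    · simp [f]
  have hlip := sub_le_dist f (by
    intro e' a ha b hb
    rw [hf e' a ha, hf e' b hb]
    split_ifs with h
    · have h1 : |b - s| ≤ |a - s| + |a - b| := by
        have := abs_sub_le b a s
        rw [abs_sub_comm b a] at this
        linarith
      have h2 := abs_nonneg (a - b)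
      rcases max_cases 0 (r - |a - s|) with h3 | h3 <;>
        rcases max_cases 0 (r - |b - s|) with h4 | h4 <;> linarith
    · simp) (Point.inner e s h₀ h₁) y
  have hx : f (Point.inner e s h₀ h₁) = r := by simp [f, hr0.le]
  have hy' : f y < r := by
    rcases y with a | ⟨e', t, k₀, k₁⟩
    · exact hr0
    · by_cases h : e' = e
      · subst h
        have hts : t ≠ s := by
          rintro rfl
          exact hy rfl
        have : 0 < |t - s| := abs_pos.mpr (sub_ne_zero.mpr hts)
        simp only [f, if_true]
        exact max_lt hr0 (by linarith)
      · simpa [f, h] using hr0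
  linarith

theorem dist_vertex_pos [Finite E] {a b : V} (hab : b ≠ a) :
    0 < dist (Point.vertex a : G.Point) (Point.vertex b) := by
  classical
  obtain ⟨r, hr0, hr⟩ : ∃ r : ℝ, 0 < r ∧ ∀ e, r ≤ G.len e := by
    rcases isEmpty_or_nonempty E with hE | hE
    · exact ⟨1, one_pos, fun e => hE.elim e⟩
    · obtain ⟨e, he⟩ := Finite.exists_min G.len
      exact ⟨G.len e, G.len_pos e, he⟩
  let F : E → ℝ → ℝ := fun e t =>
    max (if G.src e = a then max 0 (r - t) else 0)
      (if G.tgt e = a then max 0 (r - (G.len e - t)) else 0)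
  let f : G.Point → ℝ := fun z => match z with
    | Point.vertex c => if c = a then r else 0
    | Point.inner e t _ _ => F e t
  have hf : ∀ e t, t ∈ Set.Icc 0 (G.len e) → f (G.edgePoint e t) = F e t := by
    intro e t ht
    have hre := hr e
    have hlen := G.len_pos e
    unfold edgePoint
    split_ifs with h1 h2
    · rfl
    · have : t = G.len e := le_antisymm ht.2 (not_lt.mp h2)
      subst this
      have : max 0 (r - G.len e) = 0 := max_eq_left (by linarith)
      simp [f, F, this, hr0.le]
      split_ifs <;> simp [hr0.le]
    · have : t = 0 := le_antisymm (not_lt.mp h1) ht.1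
      subst this
      have : max 0 (r - G.len e) = 0 := max_eq_left (by linarith)
      simp [f, F, this, hr0.le]
      split_ifs <;> simp [hr0.le]
  have hlip := sub_le_dist f (by
    intro e s hs t ht
    rw [hf e s hs, hf e t ht]
    have h1 := le_abs_self (s - t)
    have h2 := neg_abs_le (s - t)
    have h3 := abs_nonneg (s - t)
    rw [sub_le_iff_le_add]
    refine max_le ?_ ?_
    · refine le_trans ?_ (add_le_add_right (le_max_left _ _) _)
      split_ifs
      · refine max_le (by have := le_max_left 0 (r - t); linarith) ?_
        have := le_max_right 0 (r - t)
        linarith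
      · linarith
    · refine le_trans ?_ (add_le_add_right (le_max_right _ _) _)
      split_ifs
      · refine max_le (by have := le_max_left 0 (r - (G.len e - t)); linarith) ?_
        have := le_max_right 0 (r - (G.len e - t))
        linarith
      · linarith) (Point.vertex a) (Point.vertex b)
  have hx : f (Point.vertex a) = r := by simp [f]
  have hy : f (Point.vertex b) = 0 := by simp [f, hab]
  linarith

/-- The compact connected metric graph `Γ` with model `G`. -/
noncomputable instance instMetricSpace [Finite E] : MetricSpace G.Point where
  dist_self x := le_antisymm (PathLength.nil x).dist_le (le_dist fun _ h => h.nonneg)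
  dist_comm x y := le_antisymm (le_dist fun _ h => h.reverse.dist_le)
    (le_dist fun _ h => h.reverse.dist_le)
  dist_triangle x y z := by
    rw [← sub_le_iff_le_add]
    refine le_dist fun L hL => ?_
    rw [sub_le_comm]
    refine le_dist fun M hM => ?_
    rw [sub_le_iff_le_add, add_comm]
    exact (hL.append hM).dist_le
  eq_of_dist_eq_zero {x y} h := by
    have hcomm : dist x y = dist y x := le_antisymm (le_dist fun _ h => h.reverse.dist_le)
      (le_dist fun _ h => h.reverse.dist_le)
    by_contra hne
    cases x with
    | inner e s h₀ h₁ => exact (dist_inner_pos (Ne.symm hne)).ne' h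
    | vertex a =>
      cases y with
      | inner e s h₀ h₁ => exact (dist_inner_pos hne).ne' (hcomm ▸ h)
      | vertex b => exact (dist_vertex_pos (fun hb => hne (by rw [hb]))).ne' h

end EdgeWeightedGraph

/-- The group of divisors on `Γ`: the free abelian group on the points. -/
abbrev Divisor (Γ : Type*) := Γ →₀ ℤ

/-- The degree of a divisor. -/
def deg {Γ : Type*} (D : Divisor Γ) : ℤ := D.sum fun _ n => n

/-- `γ` is a segment (an arc) of `Γ ∖ A` with open end `p`: it starts at `p`, and apart
from this end it lies in `Γ ∖ A`. -/
def IsSegment {Γ : Type*} [TopologicalSpace Γ] (A : Set Γ) (p : Γ) (γ : C(unitInterval, Γ)) :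
    Prop :=
  Function.Injective γ ∧ γ 0 = p ∧ ∀ s, 0 < s → γ s ∉ A

/-- The out-degree of `p` from `A`: the maximal number of internally disjoint segments of `Γ ∖ A`
with open end `p`. -/
noncomputable def outdeg {Γ : Type*} [TopologicalSpace Γ] (A : Set Γ) (p : Γ) : ℕ :=
  sSup {n : ℕ | ∃ γ : Fin n → C(unitInterval, Γ), (∀ i, IsSegment A p (γ i)) ∧
    ∀ i j, i ≠ j → Disjoint (γ i '' Set.Ioo 0 1) (γ j '' Set.Ioo 0 1)}

/-- A point `p` of the boundary of `A` is saturated for `D` with respect to `A`. -/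
def IsSaturated {Γ : Type*} [TopologicalSpace Γ] (D : Divisor Γ) (A : Set Γ) (p : Γ) : Prop :=
  (outdeg A p : ℤ) ≤ D p

/-- `D` is a `v₀`-reduced divisor. -/
def IsReduced {Γ : Type*} [TopologicalSpace Γ] (v₀ : Γ) (D : Divisor Γ) : Prop :=
  (∀ p, p ≠ v₀ → 0 ≤ D p) ∧
    ∀ A : Set Γ, IsCompact A → A.Nonempty → v₀ ∉ A → ∃ p ∈ frontier A, ¬ IsSaturated D A p

end MetricGraph

namespace MetricGraph

open Set Filter Topology

/-! After subdivision, Γ becomes a finite loopless graph with vertex set S and edge set F in which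
v₀ and the support of D are vertices; subdividing does not change |F| - |S|. On such a model,
reducedness is Dhar's burning criterion. A fire starts at v₀, and a vertex s burns as soon as more
than D(s) edges join it to burnt vertices. If D is supported on the vertices and nonnegative off v₀,
it is v₀-reduced exactly when every vertex burns (`burnt_of_isReduced`, `isReduced_of_burnt`).

Fix a burning order. Each edge is counted once, at the end that burns later. So the numbers of edges
from s back to the vertices burnt before it sum to |F| over s ≠ v₀, and each is at least D(s) + 1.
The degree bound says that the sum of the D(s) + 1 is smaller than |F|, because g - 1 ≤ |E(G)| -
|V(G)| (`genus_add_card_le`). Hence some vertex w has an edge to spare, and D + [w] still burns in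
the same order (`Burnt.exists_add`).

The topological work compares out-degrees, defined by arbitrary arcs, with edge counts:
`segment_count_le` bounds them above and `le_outdeg_of_edgesTo` below. -/

/-! ### Loopless cell structures and their topology. -/

/-- A loopless cell structure on the space `X`: vertices `pt s`, and edges parametrized by
`arc e` on the interval `[lo e, hi e]`. -/
structure CellModel (S F X : Type*) [TopologicalSpace X] where
  pt : S → X
  src : F → S
  tgt : F → S
  arc : F → ℝ → X
  lo : F → ℝ
  hi : F → ℝ
  lo_lt_hi : ∀ e, lo e < hi e
  continuous_arc : ∀ e, Continuous (arc e)
  arc_lo : ∀ e, arc e (lo e) = pt (src e)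
  arc_hi : ∀ e, arc e (hi e) = pt (tgt e)
  src_ne_tgt : ∀ e, src e ≠ tgt e
  pt_injective : Function.Injective pt
  arc_inj : ∀ e e' t t', t ∈ Ioo (lo e) (hi e) → t' ∈ Ioo (lo e') (hi e') →
    arc e t = arc e' t' → e = e' ∧ t = t'
  arc_ne_pt : ∀ e t s, t ∈ Ioo (lo e) (hi e) → arc e t ≠ pt s
  cover : ∀ x, (∃ s, pt s = x) ∨ ∃ e, ∃ t ∈ Ioo (lo e) (hi e), arc e t = x

namespace CellModel

variable {S F X : Type*} [TopologicalSpace X]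

/-- The same cell structure with all edges reversed. -/
def flip (M : CellModel S F X) : CellModel S F X where
  pt := M.pt
  src := M.tgt
  tgt := M.src
  arc e t := M.arc e (-t)
  lo e := -M.hi e
  hi e := -M.lo e
  lo_lt_hi e := neg_lt_neg (M.lo_lt_hi e)
  continuous_arc e := (M.continuous_arc e).comp continuous_neg
  arc_lo e := by simp [M.arc_hi]
  arc_hi e := by simp [M.arc_lo]
  src_ne_tgt e := (M.src_ne_tgt e).symm
  pt_injective := M.pt_injective
  arc_inj e e' t t' ht ht' h := by
    have := M.arc_inj e e' (-t) (-t') ⟨by linarith [ht.2], by linarith [ht.1]⟩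
      ⟨by linarith [ht'.2], by linarith [ht'.1]⟩ h
    exact ⟨this.1, neg_injective this.2⟩
  arc_ne_pt e t s ht := M.arc_ne_pt e (-t) s ⟨by linarith [ht.2], by linarith [ht.1]⟩
  cover x := by
    rcases M.cover x with h | ⟨e, t, ht, rfl⟩
    · exact Or.inl h
    · exact Or.inr ⟨e, -t, ⟨by linarith [ht.2], by linarith [ht.1]⟩, by simp⟩

open Classical in
/-- The cell structure in which the edge `a` is subdivided at the parameter `c`. -/
noncomputable def subdivide (M : CellModel S F X) (a : F) (c : ℝ)
    (hc : c ∈ Ioo (M.lo a) (M.hi a)) : CellModel (Option S) (Option F) X where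
  -- As a vertex, `none` is the new point; as an edge, it is the upper part of `a`, while `some a`
  -- keeps the lower part.
  pt o := o.elim (M.arc a c) M.pt
  src o := o.elim none (fun e => some (M.src e))
  tgt o := o.elim (some (M.tgt a)) (fun e => if e = a then none else some (M.tgt e))
  arc o := o.elim (M.arc a) M.arc
  lo o := o.elim c M.lo
  hi o := o.elim (M.hi a) (fun e => if e = a then c else M.hi e)
  lo_lt_hi := by
    rintro (_ | e)
    · exact hc.2
    · by_cases h : e = a
      · subst h; simpa using hc.1
      · simpa [h] using M.lo_lt_hi e
  continuous_arc := by
    rintro (_ | e)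
    exacts [M.continuous_arc a, M.continuous_arc e]
  arc_lo := by
    rintro (_ | e)
    exacts [rfl, M.arc_lo e]
  arc_hi := by
    rintro (_ | e)
    · exact M.arc_hi a
    · by_cases h : e = a
      · subst h; simp
      · simpa [h] using M.arc_hi e
  src_ne_tgt := by
    rintro (_ | e)
    · simp
    · by_cases h : e = a
      · simp [h]
      · simpa [h] using M.src_ne_tgt e
  pt_injective := by
    rintro (_ | s) (_ | s') h
    · rfl
    · exact absurd h (M.arc_ne_pt a c s' hc)
    · exact absurd h.symm (M.arc_ne_pt a c s hc)
    · exact congrArg some (M.pt_injective h)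
  arc_inj := by
    have key : ∀ e t, t ∈ Ioo (M.lo e) (if e = a then c else M.hi e) →
        t ∈ Ioo (M.lo e) (M.hi e) := by
      intro e t ht
      split_ifs at ht with h
      · subst h; exact ⟨ht.1, ht.2.trans hc.2⟩
      · exact ht
    rintro (_ | e) (_ | e') t t' ht ht' h
    · exact ⟨rfl, (M.arc_inj a a t t' ⟨hc.1.trans ht.1, ht.2⟩ ⟨hc.1.trans ht'.1, ht'.2⟩ h).2⟩
    · obtain ⟨rfl, rfl⟩ := M.arc_inj a e' t t' ⟨hc.1.trans ht.1, ht.2⟩ (key e' t' ht') h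
      have h1 : t < c := by simpa using ht'.2
      exact absurd h1 (not_lt.mpr ht.1.le)
    · obtain ⟨rfl, rfl⟩ := M.arc_inj e a t t' (key e t ht) ⟨hc.1.trans ht'.1, ht'.2⟩ h
      have h1 : t < c := by simpa using ht.2
      exact absurd h1 (not_lt.mpr ht'.1.le)
    · obtain ⟨h1, h2⟩ := M.arc_inj e e' t t' (key e t ht) (key e' t' ht') h
      exact ⟨congrArg some h1, h2⟩
  arc_ne_pt := by
    rintro (_ | e) t (_ | s) ht h
    · exact ht.1.ne' (M.arc_inj a a t c ⟨hc.1.trans ht.1, ht.2⟩ hc h).2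
    · exact M.arc_ne_pt a t s ⟨hc.1.trans ht.1, ht.2⟩ h
    · by_cases hea : e = a
      · subst hea
        have h1 : M.lo e < t ∧ t < c := by simpa using ht
        exact h1.2.ne (M.arc_inj e e t c ⟨h1.1, h1.2.trans hc.2⟩ hc h).2
      · have h1 : t ∈ Ioo (M.lo e) (M.hi e) := by simpa [hea] using ht
        exact hea (M.arc_inj e a t c h1 hc h).1
    · by_cases hea : e = a
      · subst hea
        have h1 : M.lo e < t ∧ t < c := by simpa using ht
        exact M.arc_ne_pt e t s ⟨h1.1, h1.2.trans hc.2⟩ h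
      · have h1 : t ∈ Ioo (M.lo e) (M.hi e) := by simpa [hea] using ht
        exact M.arc_ne_pt e t s h1 h
  cover x := by
    rcases M.cover x with ⟨s, hs⟩ | ⟨e, t, ht, h⟩
    · exact Or.inl ⟨some s, hs⟩
    · by_cases hea : e = a
      · subst hea
        rcases lt_trichotomy t c with h1 | h1 | h1
        · exact Or.inr ⟨some e, t, ⟨ht.1, by simpa using h1⟩, h⟩
        · exact Or.inl ⟨none, h1 ▸ h⟩
        · exact Or.inr ⟨none, t, ⟨h1, ht.2⟩, h⟩
      · exact Or.inr ⟨some e, t, ⟨ht.1, by simpa [hea] using ht.2⟩, h⟩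

/-- Looplessness extends injectivity from the open edge to the closed one. -/
theorem arc_injOn (M : CellModel S F X) (e : F) : InjOn (M.arc e) (Icc (M.lo e) (M.hi e)) := by
  have hne : M.arc e (M.lo e) ≠ M.arc e (M.hi e) := by
    rw [M.arc_lo, M.arc_hi]
    exact fun h => M.src_ne_tgt e (M.pt_injective h)
  intro t ht t' ht' h
  rcases eq_endpoints_or_mem_Ioo_of_mem_Icc ht with rfl | rfl | h1 <;>
    rcases eq_endpoints_or_mem_Ioo_of_mem_Icc ht' with rfl | rfl | h2
  · rfl
  · exact absurd h hne
  · exact absurd (h.symm.trans (M.arc_lo e)) (M.arc_ne_pt e t' _ h2)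
  · exact absurd h.symm hne
  · rfl
  · exact absurd (h.symm.trans (M.arc_hi e)) (M.arc_ne_pt e t' _ h2)
  · exact absurd (h.trans (M.arc_lo e)) (M.arc_ne_pt e t _ h1)
  · exact absurd (h.trans (M.arc_hi e)) (M.arc_ne_pt e t _ h1)
  · exact (M.arc_inj e e t t' h1 h2 h).2

theorem isCompact_arc_image (M : CellModel S F X) (e : F) (a b : ℝ) :
    IsCompact (M.arc e '' Icc a b) :=
  isCompact_Icc.image (M.continuous_arc e)

/-- The complement is a finite union of compact sets: the vertices, the other closed edges and the
two remaining pieces of `e`. Thus finiteness and the Hausdorff property suffice to control the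
topology of `X`. -/
theorem isOpen_arc_image [T2Space X] [Finite S] [Finite F] (M : CellModel S F X) (e : F) {a b : ℝ}
    (ha : M.lo e ≤ a) (hb : b ≤ M.hi e) : IsOpen (M.arc e '' Ioo a b) := by
  have hcl : IsClosed (range M.pt ∪ (⋃ e' ∈ {e' | e' ≠ e}, M.arc e' '' Icc (M.lo e') (M.hi e')) ∪
      (M.arc e '' Icc (M.lo e) a ∪ M.arc e '' Icc b (M.hi e))) := by
    refine ((finite_range _).isClosed.union ?_).union
      ((M.isCompact_arc_image _ _ _).isClosed.union (M.isCompact_arc_image _ _ _).isClosed)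
    exact (toFinite _).isClosed_biUnion fun e' _ => (M.isCompact_arc_image _ _ _).isClosed
  rw [← isClosed_compl_iff]
  convert hcl using 1
  ext x
  constructor
  · intro hx
    rcases M.cover x with ⟨s, rfl⟩ | ⟨e', t, ht, rfl⟩
    · exact Or.inl (Or.inl ⟨s, rfl⟩)
    · by_cases he : e' = e
      · subst he
        by_cases h1 : a < t
        · by_cases h2 : t < b
          · exact absurd ⟨t, ⟨h1, h2⟩, rfl⟩ hx
          · exact Or.inr (Or.inr ⟨t, ⟨not_lt.mp h2, ht.2.le⟩, rfl⟩)
        · exact Or.inr (Or.inl ⟨t, ⟨ht.1.le, not_lt.mp h1⟩, rfl⟩)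
      · exact Or.inl (Or.inr (mem_biUnion (show e' ∈ {e' | e' ≠ e} from he)
          ⟨t, Ioo_subset_Icc_self ht, rfl⟩))
  · rintro hx ⟨t, ht, rfl⟩
    have ht' : t ∈ Ioo (M.lo e) (M.hi e) := ⟨ha.trans_lt ht.1, ht.2.trans_le hb⟩
    rcases hx with (⟨s, h⟩ | h) | ⟨u, hu, h⟩ | ⟨u, hu, h⟩
    · exact M.arc_ne_pt e t s ht' h.symm
    · simp only [mem_iUnion] at h
      obtain ⟨e', he', u, hu, h⟩ := h
      rcases eq_endpoints_or_mem_Ioo_of_mem_Icc hu with rfl | rfl | h1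
      · exact M.arc_ne_pt e t _ ht' (h.symm.trans (M.arc_lo e'))
      · exact M.arc_ne_pt e t _ ht' (h.symm.trans (M.arc_hi e'))
      · exact he' (M.arc_inj e' e u t h1 ht' h).1
    · have := M.arc_injOn e ⟨hu.1, hu.2.trans (ht.1.le.trans ht'.2.le)⟩
        (Ioo_subset_Icc_self ht') h
      exact absurd hu.2 (not_le.mpr (this ▸ ht.1))
    · have := M.arc_injOn e ⟨ht'.1.le.trans (ht.2.le.trans hu.1), hu.2⟩
        (Ioo_subset_Icc_self ht') h
      exact absurd hu.1 (not_le.mpr (this ▸ ht.2))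

/-! ### Germs of edges and the initial behaviour of arcs. -/

open Classical in
/-- The germ of the edge `e` at its end `s`. -/
noncomputable def germ (M : CellModel S F X) (e : F) (s : S) : Filter X :=
  -- Without loops at most one end is `s`. For an edge that misses `s`, the second branch is a
  -- harmless default.
  if M.src e = s then map (M.arc e) (𝓝[>] (M.lo e)) else map (M.arc e) (𝓝[<] (M.hi e))

instance germ_neBot (M : CellModel S F X) (e : F) (s : S) : (M.germ e s).NeBot := by
  unfold germ
  split_ifs <;> infer_instance

theorem arc_image_mem_germ (M : CellModel S F X) (e : F) (s : S) :
    M.arc e '' Ioo (M.lo e) (M.hi e) ∈ M.germ e s := by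
  unfold germ
  split_ifs
  · exact image_mem_map (Ioo_mem_nhdsGT (M.lo_lt_hi e))
  · exact image_mem_map (Ioo_mem_nhdsLT (M.lo_lt_hi e))

/-- A connected set that avoids the target of `e`, contains the source of `e` and the point with
parameter `τ` contains all points of `e` with smaller parameter. -/
theorem arc_mem_of_isPreconnected [T2Space X] [Finite S] [Finite F] (M : CellModel S F X) {e : F}
    {C : Set X} (hC : IsPreconnected C) (hsrc : M.pt (M.src e) ∈ C) (htgt : M.pt (M.tgt e) ∉ C)
    {τ σ : ℝ} (hτ : τ < M.hi e) (h : M.arc e τ ∈ C) (hσ : M.lo e < σ) (hστ : σ < τ) :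
    M.arc e σ ∈ C := by
  by_contra hn
  -- The part of the edge beyond σ is cut off from the rest of `C`: both of its ends, the point at σ
  -- and the target, are missing from `C`.
  have := hC (M.arc e '' Ioo σ (M.hi e)) (M.arc e '' Icc σ (M.hi e))ᶜ
    (M.isOpen_arc_image e hσ.le le_rfl) (M.isCompact_arc_image _ _ _).isClosed.isOpen_compl
    (by
      intro x hx
      by_cases hxe : x ∈ M.arc e '' Icc σ (M.hi e)
      · obtain ⟨t, ht, rfl⟩ := hxe
        rcases eq_endpoints_or_mem_Ioo_of_mem_Icc ht with rfl | rfl | h1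
        · exact absurd hx hn
        · exact absurd (M.arc_hi e ▸ hx) htgt
        · exact Or.inl ⟨t, h1, rfl⟩
      · exact Or.inr hxe)
    ⟨_, h, τ, ⟨hστ, hτ⟩, rfl⟩
    ⟨_, hsrc, by
      rintro ⟨t, ht, h⟩
      rw [← M.arc_lo] at h
      have := M.arc_injOn e ⟨hσ.le.trans ht.1, ht.2⟩ ⟨le_rfl, (M.lo_lt_hi e).le⟩ h
      exact absurd ht.1 (not_le.mpr (this ▸ hσ))⟩
  obtain ⟨x, -, hx1, hx2⟩ := this
  exact hx2 (image_mono Ioo_subset_Icc_self hx1)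

/-- An injective path that starts at a vertex first runs along an edge. -/
theorem exists_image_mem_germ [T2Space X] [Finite S] [Finite F] (M : CellModel S F X) (s : S)
    (γ : C(unitInterval, X)) (hγ : Function.Injective γ) (h0 : γ 0 = M.pt s) :
    ∃ e, (M.src e = s ∨ M.tgt e = s) ∧ γ '' Ioo 0 1 ∈ M.germ e s := by
  have hfin : IsClosed (M.pt '' {s}ᶜ) := (toFinite _).isClosed
  have hU : γ ⁻¹' (M.pt '' {s}ᶜ)ᶜ ∈ 𝓝 (0 : unitInterval) := by
    refine γ.continuous.continuousAt.preimage_mem_nhds (hfin.isOpen_compl.mem_nhds ?_)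
    rintro ⟨s', hs', h⟩
    exact hs' (M.pt_injective (h.trans h0))
  -- Up to time ε the path meets no vertex other than `s`, so the edge containing `γ ε` is the one
  -- it leaves along.
  obtain ⟨ε, hε0, hε1, hε⟩ : ∃ ε : unitInterval, 0 < ε ∧ ε < 1 ∧
      ∀ u ∈ Icc 0 ε, γ u ∉ M.pt '' {s}ᶜ := by
    obtain ⟨b, hb, hb'⟩ := (mem_nhdsGE_iff_exists_Ico_subset' (zero_lt_one' unitInterval)).mp
      (mem_nhdsWithin_of_mem_nhds hU)
    obtain ⟨ε, h1, h2⟩ := exists_between (show (0 : unitInterval) < b from hb)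
    exact ⟨ε, h1, h2.trans_le unitInterval.le_one', fun u hu => hb' ⟨hu.1, hu.2.trans_lt h2⟩⟩
  have hCon : IsPreconnected (γ '' Icc 0 ε) := isPreconnected_Icc.image _ γ.continuous.continuousOn
  have hsC : M.pt s ∈ γ '' Icc 0 ε := ⟨0, ⟨le_rfl, hε0.le⟩, h0⟩
  have hpt : ∀ s', M.pt s' ∈ γ '' Icc 0 ε → s' = s := by
    rintro s' ⟨u, hu, h⟩
    by_contra hne
    exact hε u hu ⟨s', hne, h.symm⟩
  have hεC : γ ε ∈ γ '' Icc 0 ε := ⟨ε, ⟨hε0.le, le_rfl⟩, rfl⟩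
  obtain ⟨e, τ, hτ, hτe⟩ : ∃ e, ∃ t ∈ Ioo (M.lo e) (M.hi e), M.arc e t = γ ε := by
    rcases M.cover (γ ε) with ⟨s', h⟩ | h
    · rw [hpt s' (h ▸ hεC), ← h0] at h
      exact absurd (hγ h) hε0.ne
    · exact h
  -- Otherwise the initial piece of the path misses both ends of `e`, and the open edge would
  -- disconnect it.
  have hinc : M.src e = s ∨ M.tgt e = s := by
    by_contra! hn
    obtain ⟨x, -, hx1, hx2⟩ := hCon (M.arc e '' Ioo (M.lo e) (M.hi e))
      (M.arc e '' Icc (M.lo e) (M.hi e))ᶜ (M.isOpen_arc_image e le_rfl le_rfl)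
      (M.isCompact_arc_image _ _ _).isClosed.isOpen_compl
      (by
        intro x hx
        by_cases hxe : x ∈ M.arc e '' Icc (M.lo e) (M.hi e)
        · obtain ⟨t, ht, rfl⟩ := hxe
          rcases eq_endpoints_or_mem_Ioo_of_mem_Icc ht with rfl | rfl | h1
          · exact absurd (hpt _ (M.arc_lo e ▸ hx)) hn.1
          · exact absurd (hpt _ (M.arc_hi e ▸ hx)) hn.2
          · exact Or.inl ⟨t, h1, rfl⟩
        · exact Or.inr hxe)
      ⟨_, hεC, τ, hτ, hτe⟩
      ⟨_, hsC, by
        rintro ⟨t, ht, h⟩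
        rcases eq_endpoints_or_mem_Ioo_of_mem_Icc ht with rfl | rfl | h1
        · exact hn.1 (M.pt_injective ((M.arc_lo e).symm.trans h))
        · exact hn.2 (M.pt_injective ((M.arc_hi e).symm.trans h))
        · exact M.arc_ne_pt e t s h1 h⟩
    exact hx2 (image_mono Ioo_subset_Icc_self hx1)
  have hopen : ∀ σ ∈ Ioo (M.lo e) (M.hi e), σ ≠ τ → M.arc e σ ∈ γ '' Icc 0 ε →
      M.arc e σ ∈ γ '' Ioo 0 1 := by
    rintro σ hσ hστ ⟨u, hu, h⟩
    have hu0 : u ≠ 0 := fun hu0 => M.arc_ne_pt e σ s hσ (by rw [← h, hu0, h0])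
    have huε : u ≠ ε := by
      rintro rfl
      exact hστ (M.arc_inj e e σ τ hσ hτ (h.symm.trans hτe.symm)).2
    exact ⟨u, ⟨lt_of_le_of_ne hu.1 hu0.symm, (lt_of_le_of_ne hu.2 huε).trans hε1⟩, h⟩
  refine ⟨e, hinc, ?_⟩
  by_cases hs : M.src e = s
  · have htgt : M.pt (M.tgt e) ∉ γ '' Icc 0 ε := fun h =>
      M.src_ne_tgt e (hs.trans (hpt _ h).symm)
    rw [germ, if_pos hs]
    filter_upwards [image_mem_map (Ioo_mem_nhdsGT hτ.1)]
    rintro _ ⟨σ, hσ, rfl⟩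
    exact hopen σ ⟨hσ.1, hσ.2.trans hτ.2⟩ hσ.2.ne
      (M.arc_mem_of_isPreconnected hCon (hs ▸ hsC) htgt hτ.2 (hτe ▸ hεC) hσ.1 hσ.2)
  · have ht : M.tgt e = s := hinc.resolve_left hs
    have hsrc : M.pt (M.src e) ∉ γ '' Icc 0 ε := fun h => hs (hpt _ h)
    rw [germ, if_neg hs]
    filter_upwards [image_mem_map (Ioo_mem_nhdsLT hτ.2)]
    rintro _ ⟨σ, hσ, rfl⟩
    refine hopen σ ⟨hτ.1.trans hσ.1, hσ.2⟩ hσ.1.ne' ?_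
    -- The same argument in the reversed structure, with negated parameters.
    have h1 := M.flip.arc_mem_of_isPreconnected (e := e) (τ := -τ) (σ := -σ) hCon
      (show M.pt (M.tgt e) ∈ _ from ht ▸ hsC) hsrc
      (neg_lt_neg hτ.1) (by simpa [flip, hτe] using hεC) (neg_lt_neg hσ.2) (neg_lt_neg hσ.1)
    simpa [flip] using h1

end CellModel

/-! ### Out-degrees as edge counts. -/

theorem IsSegment.mem_frontier {X : Type*} [TopologicalSpace X] {A : Set X} {p : X}
    {γ : C(unitInterval, X)} (h : IsSegment A p γ) (hp : p ∈ A) : p ∈ frontier A := by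
  rw [frontier_eq_closure_inter_closure]
  refine ⟨subset_closure hp, ?_⟩
  have h0 : (0 : unitInterval) ∈ closure (Ioi 0) := by
    rw [closure_Ioi' (a := (0 : unitInterval)) ⟨1, zero_lt_one' unitInterval⟩]
    exact self_mem_Ici
  rw [← h.2.1]
  exact closure_mono (by rintro _ ⟨u, hu, rfl⟩; exact h.2.2 u hu)
    (image_closure_subset_closure_image γ.continuous ⟨0, h0, rfl⟩)

namespace CellModel

variable {S F X : Type*} [TopologicalSpace X]

/-- Each segment starts along an edge at `s`. Two segments using the same edge would both contain a
part of its germ, against disjointness; an edge whose interior lies in `A` cannot be used at all. -/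
theorem segment_count_le [T2Space X] [Finite S] [Fintype F] (M : CellModel S F X) (A : Set X)
    (s : S) {n : ℕ} (γ : Fin n → C(unitInterval, X)) (hγ : ∀ i, IsSegment A (M.pt s) (γ i))
    (hdisj : ∀ i j, i ≠ j → Disjoint (γ i '' Ioo 0 1) (γ j '' Ioo 0 1)) (T : Finset F)
    (hT : ∀ e, (M.src e = s ∨ M.tgt e = s) → ¬ M.arc e '' Ioo (M.lo e) (M.hi e) ⊆ A → e ∈ T) :
    n ≤ T.card := by
  choose e he hmem using fun i => M.exists_image_mem_germ s (γ i) (hγ i).1 (hγ i).2.1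
  have hinj : Function.Injective e := by
    intro i j hij
    by_contra hne
    obtain ⟨x, hx1, hx2⟩ := (M.germ_neBot (e i) s).nonempty_of_mem
      (inter_mem (hmem i) (hij ▸ hmem j))
    exact (hdisj i j hne).le_bot ⟨hx1, hx2⟩
  have hmap : ∀ i, e i ∈ T := by
    intro i
    refine hT _ (he i) fun hA => ?_
    obtain ⟨x, ⟨u, hu, rfl⟩, hx⟩ := (M.germ_neBot (e i) s).nonempty_of_mem
      (inter_mem (hmem i) (M.arc_image_mem_germ (e i) s))
    exact (hγ i).2.2 u hu.1 (hA hx)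
  simpa using Finset.card_le_card_of_injOn e (s := Finset.univ) (fun i _ => hmap i) hinj.injOn

theorem outdeg_le [T2Space X] [Finite S] [Fintype F] (M : CellModel S F X) (A : Set X) (s : S)
    (T : Finset F)
    (hT : ∀ e, (M.src e = s ∨ M.tgt e = s) → ¬ M.arc e '' Ioo (M.lo e) (M.hi e) ⊆ A → e ∈ T) :
    outdeg A (M.pt s) ≤ T.card :=
  csSup_le' fun _ ⟨γ, hγ, hdisj⟩ => M.segment_count_le A s γ hγ hdisj T hT

/-- The defining set of the out-degree is bounded, so that the out-degree is a maximum. -/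
theorem le_outdeg [T2Space X] [Finite S] [Finite F] (M : CellModel S F X) (A : Set X) (p : X)
    {n : ℕ} (γ : Fin n → C(unitInterval, X)) (hγ : ∀ i, IsSegment A p (γ i))
    (hdisj : ∀ i j, i ≠ j → Disjoint (γ i '' Ioo 0 1) (γ j '' Ioo 0 1)) : n ≤ outdeg A p := by
  have := Fintype.ofFinite F
  -- In `ℕ` the supremum of an unbounded set is 0, so a bound is needed here. If `p` lies inside an
  -- edge, subdividing there makes it a vertex.
  refine le_csSup ?_ ⟨γ, hγ, hdisj⟩
  rcases M.cover p with ⟨s, rfl⟩ | ⟨e, c, hc, rfl⟩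
  · exact ⟨_, fun n ⟨γ, hγ, hdisj⟩ =>
      M.segment_count_le A s γ hγ hdisj Finset.univ fun _ _ _ => Finset.mem_univ _⟩
  · exact ⟨_, fun n ⟨γ, hγ, hdisj⟩ =>
      (M.subdivide e c hc).segment_count_le A none γ hγ hdisj Finset.univ
        fun _ _ _ => Finset.mem_univ _⟩

/-- The path along the edge `e` from the parameter `a` to the parameter `b`. -/
noncomputable def path (M : CellModel S F X) (e : F) (a b : ℝ) : C(unitInterval, X) where
  toFun u := M.arc e (AffineMap.lineMap a b (u : ℝ))
  continuous_toFun := (M.continuous_arc e).comp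
    (AffineMap.lineMap_continuous.comp continuous_subtype_val)

theorem path_image_subset (M : CellModel S F X) (e : F) {a b : ℝ} (hab : a ≠ b) :
    M.path e a b '' Ioo 0 1 ⊆ M.arc e '' Ioo (min a b) (max a b) := by
  rintro _ ⟨u, hu, rfl⟩
  refine ⟨_, ?_, rfl⟩
  have h0 : 0 < (u : ℝ) := hu.1
  have h1 : (u : ℝ) < 1 := hu.2
  rw [AffineMap.lineMap_apply_ring']
  rcases hab.lt_or_gt with h | h
  · rw [min_eq_left h.le, max_eq_right h.le]
    constructor <;> nlinarith
  · rw [min_eq_right h.le, max_eq_left h.le]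
    constructor <;> nlinarith

theorem isSegment_path (M : CellModel S F X) {e : F} {a b : ℝ} (hab : a ≠ b)
    (ha : a ∈ Icc (M.lo e) (M.hi e)) (hb : b ∈ Icc (M.lo e) (M.hi e)) {A : Set X}
    (hA : ∀ t, t ∈ Ioo (min a b) (max a b) → M.arc e t ∉ A) (hbA : M.arc e b ∉ A) :
    IsSegment A (M.arc e a) (M.path e a b) := by
  refine ⟨?_, ?_, ?_⟩
  · intro u u' h
    have hmem : ∀ u : unitInterval, AffineMap.lineMap a b (u : ℝ) ∈ Icc (M.lo e) (M.hi e) :=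
      fun u => (convex_Icc (M.lo e) (M.hi e)).lineMap_mem ha hb u.2
    exact Subtype.ext (AffineMap.lineMap_injective ℝ hab (M.arc_injOn e (hmem u) (hmem u') h))
  · simp [path]
  · intro u hu
    rcases eq_or_lt_of_le (unitInterval.le_one' (t := u)) with rfl | h1
    · simpa [path] using hbA
    · obtain ⟨t, ht, h⟩ := M.path_image_subset e hab ⟨u, ⟨hu, h1⟩, rfl⟩
      exact h ▸ hA t ht

/-- If a closed set contains a point of an open edge, but not a later one, then it has a boundary
point of positive out-degree on this open edge. -/
theorem exists_frontier_of_lt [T2Space X] [Finite S] [Finite F] (M : CellModel S F X) {A : Set X}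
    (hA : IsClosed A) {e : F} {t y : ℝ} (ht : M.lo e < t) (hty : t < y) (hy : y < M.hi e)
    (htA : M.arc e t ∈ A) (hyA : M.arc e y ∉ A) :
    ∃ x ∈ Ioo (M.lo e) (M.hi e), M.arc e x ∈ frontier A ∧ 0 < outdeg A (M.arc e x) := by
  have hK : IsCompact (Icc t y ∩ M.arc e ⁻¹' A) :=
    isCompact_Icc.inter_right (hA.preimage (M.continuous_arc e))
  -- The last point of `A` before `y`: the stretch from it to `y` is a segment outside `A`.
  obtain ⟨x, ⟨hx, hxA⟩, hmax⟩ := hK.exists_isGreatest ⟨t, ⟨le_rfl, hty.le⟩, htA⟩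
  have hxy : x < y := lt_of_le_of_ne hx.2 (by rintro rfl; exact hyA hxA)
  have hseg : IsSegment A (M.arc e x) (M.path e x y) := by
    refine M.isSegment_path hxy.ne ⟨ht.le.trans hx.1, hx.2.trans hy.le⟩
      ⟨(ht.trans hty).le, hy.le⟩ (fun z hz hzA => ?_) hyA
    rw [min_eq_left hxy.le, max_eq_right hxy.le] at hz
    exact absurd (hmax ⟨⟨hx.1.trans hz.1.le, hz.2.le⟩, hzA⟩) (not_le.mpr hz.1)
  refine ⟨x, ⟨ht.trans_le hx.1, hxy.trans hy⟩, hseg.mem_frontier hxA, ?_⟩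
  exact M.le_outdeg A _ (n := 1) (fun _ => M.path e x y) (fun _ => hseg)
    fun i j h => absurd (Subsingleton.elim i j) h

theorem exists_frontier_of_ne [T2Space X] [Finite S] [Finite F] (M : CellModel S F X) {A : Set X}
    (hA : IsClosed A) {e : F} {t y : ℝ} (ht : t ∈ Ioo (M.lo e) (M.hi e))
    (hy : y ∈ Ioo (M.lo e) (M.hi e)) (htA : M.arc e t ∈ A) (hyA : M.arc e y ∉ A) :
    ∃ x ∈ Ioo (M.lo e) (M.hi e), M.arc e x ∈ frontier A ∧ 0 < outdeg A (M.arc e x) := by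
  rcases lt_trichotomy t y with h | rfl | h
  · exact M.exists_frontier_of_lt hA ht.1 h hy.2 htA hyA
  · exact absurd htA hyA
  · obtain ⟨x, hx, h1, h2⟩ := M.flip.exists_frontier_of_lt hA (e := e) (t := -t) (y := -y)
      (neg_lt_neg ht.2) (neg_lt_neg h) (neg_lt_neg hy.1) (by simpa [flip] using htA)
      (by simpa [flip] using hyA)
    exact ⟨-x, ⟨lt_neg_of_lt_neg hx.2, neg_lt_of_neg_lt hx.1⟩, h1, h2⟩

end CellModel

/-! ### Dhar's burning process on a finite graph. -/

section Burning

variable {S F : Type*} [Fintype F] [DecidableEq S]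

/-- The edges that join `s` to a vertex in `B`. -/
def edgesTo (src tgt : F → S) (s : S) (B : Finset S) : Finset F :=
  {e | (src e = s ∧ tgt e ∈ B) ∨ (tgt e = s ∧ src e ∈ B)}

/-- The edges with both ends in `B`. -/
def edgesWithin (src tgt : F → S) (B : Finset S) : Finset F :=
  {e | src e ∈ B ∧ tgt e ∈ B}

/-- The vertex sets that Dhar's algorithm can burn for the divisor `D`, starting at `s₀`. -/
inductive Burnt (src tgt : F → S) (s₀ : S) (D : S → ℤ) : Finset S → Prop
  | base : Burnt src tgt s₀ D {s₀}
  | step {B : Finset S} {s : S} (hB : Burnt src tgt s₀ D B) (hs : s ∉ B)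
      (h : D s < (edgesTo src tgt s B).card) : Burnt src tgt s₀ D (insert s B)

variable {src tgt : F → S} {s₀ : S} {D D' : S → ℤ} {B : Finset S}

theorem Burnt.mem_base (h : Burnt src tgt s₀ D B) : s₀ ∈ B := by
  induction h with
  | base => simp
  | step _ _ _ ih => exact Finset.mem_insert_of_mem ih

theorem Burnt.congr (h : Burnt src tgt s₀ D B) (hD : ∀ s ∈ B, D s = D' s) :
    Burnt src tgt s₀ D' B := by
  induction h with
  | base => exact .base
  | @step B s _ hs h ih =>
    refine .step (ih fun s hs => hD s (Finset.mem_insert_of_mem hs)) hs ?_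
    rwa [← hD s (Finset.mem_insert_self _ _)]

/-- Without loops, every edge gained by adding `s` joins it to `B`. -/
theorem card_edgesWithin_insert (hloop : ∀ e, src e ≠ tgt e) {s : S} (hs : s ∉ B) :
    (edgesWithin src tgt (insert s B)).card =
      (edgesWithin src tgt B).card + (edgesTo src tgt s B).card := by
  classical
  rw [← Finset.card_union_of_disjoint]
  · congr 1
    ext e
    have := hloop e
    simp only [edgesWithin, edgesTo, Finset.mem_union, Finset.mem_filter, Finset.mem_univ,
      true_and, Finset.mem_insert]
    grind
  · rw [Finset.disjoint_left]
    intro e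
    simp only [edgesWithin, edgesTo, Finset.mem_filter, Finset.mem_univ, true_and]
    grind

/-- If `D` has fewer chips off `s₀` than the number of independent cycles in a burnt set `B`,
then a chip can be added to `D` so that `B` is still burnt. -/
theorem Burnt.exists_add (hloop : ∀ e, src e ≠ tgt e) (h : Burnt src tgt s₀ D B)
    (hsum : ∑ s ∈ B.erase s₀, D s + B.card < (edgesWithin src tgt B).card + 1) :
    ∃ w ∈ B, w ≠ s₀ ∧ Burnt src tgt s₀ (D + Pi.single w 1) B := by
  induction h with
  | base =>
    have : edgesWithin src tgt {s₀} = ∅ := by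
      ext e
      have := hloop e
      simp only [edgesWithin, Finset.mem_filter, Finset.mem_univ, true_and, Finset.mem_singleton,
        Finset.notMem_empty, iff_false]
      grind
    simp [this] at hsum
  | @step B s hB hs h ih =>
    have hs0 : s ≠ s₀ := by rintro rfl; exact hs hB.mem_base
    -- If the last burnt vertex has an edge to spare, the chip goes there.
    by_cases hlt : D s + 1 < (edgesTo src tgt s B).card
    · refine ⟨s, Finset.mem_insert_self _ _, hs0, .step (hB.congr fun v hv => ?_) hs
        (by simpa using hlt)⟩
      have : v ≠ s := by rintro rfl; exact hs hv
      simp [this]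
    -- With no edge to spare, removing `s` lowers the left side of `hsum` by at least as much as the
    -- right side, so the strict inequality passes to `B`.
    · rw [Finset.erase_insert_of_ne hs0, Finset.sum_insert (by simp [hs]),
        Finset.card_insert_of_notMem hs, card_edgesWithin_insert hloop hs] at hsum
      push_cast at hsum
      obtain ⟨w, hwB, hw0, hw⟩ := ih (by linarith)
      have : s ≠ w := by rintro rfl; exact hs hwB
      exact ⟨w, Finset.mem_insert_of_mem hwB, hw0, .step hw hs (by simpa [this] using h)⟩

end Burning

/-! ### Reducedness is equivalent to burning. -/

namespace CellModel

variable {S F X : Type*} [TopologicalSpace X]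

/-- Every edge from `s` to `B` is itself a segment: were an interior point in `A`, its end in `B`
would be too. Distinct edges have disjoint interiors. -/
theorem le_outdeg_of_edgesTo [T2Space X] [Finite S] [Fintype F] [DecidableEq S]
    (M : CellModel S F X) {A : Set X} {s : S} {B : Finset S} (hs : M.pt s ∈ A)
    (hB : ∀ b ∈ B, M.pt b ∉ A)
    (hA : ∀ e, ∀ t ∈ Ioo (M.lo e) (M.hi e), M.arc e t ∈ A →
      M.pt (M.src e) ∈ A ∧ M.pt (M.tgt e) ∈ A)
    (hpos : 0 < (edgesTo M.src M.tgt s B).card) :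
    M.pt s ∈ frontier A ∧ (edgesTo M.src M.tgt s B).card ≤ outdeg A (M.pt s) := by
  have hex : ∀ e ∈ edgesTo M.src M.tgt s B, ∃ γ, IsSegment A (M.pt s) γ ∧
      γ '' Ioo 0 1 ⊆ M.arc e '' Ioo (M.lo e) (M.hi e) := by
    intro e he
    have hle := (M.lo_lt_hi e).le
    simp only [edgesTo, Finset.mem_filter, Finset.mem_univ, true_and] at he
    rcases he with ⟨rfl, h⟩ | ⟨rfl, h⟩
    · refine ⟨M.path e (M.lo e) (M.hi e), ?_, ?_⟩
      · rw [← M.arc_lo]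
        refine M.isSegment_path (M.lo_lt_hi e).ne ⟨le_rfl, hle⟩ ⟨hle, le_rfl⟩ ?_ ?_
        · rw [min_eq_left hle, max_eq_right hle]
          exact fun t ht htA => hB _ h (hA e t ht htA).2
        · rw [M.arc_hi]
          exact hB _ h
      · have := M.path_image_subset e (M.lo_lt_hi e).ne
        rwa [min_eq_left hle, max_eq_right hle] at this
    · refine ⟨M.path e (M.hi e) (M.lo e), ?_, ?_⟩
      · rw [← M.arc_hi]
        refine M.isSegment_path (M.lo_lt_hi e).ne' ⟨hle, le_rfl⟩ ⟨le_rfl, hle⟩ ?_ ?_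
        · rw [min_eq_right hle, max_eq_left hle]
          exact fun t ht htA => hB _ h (hA e t ht htA).1
        · rw [M.arc_lo]
          exact hB _ h
      · have := M.path_image_subset e (M.lo_lt_hi e).ne'
        rwa [min_eq_right hle, max_eq_left hle] at this
  have : Nonempty C(unitInterval, X) := ⟨.const _ (M.pt s)⟩
  choose! γ hγ hsub using hex
  constructor
  · obtain ⟨e, he⟩ := Finset.card_pos.mp hpos
    exact (hγ e he).mem_frontier hs
  · set T := edgesTo M.src M.tgt s B
    refine M.le_outdeg A _ (fun i => γ (T.equivFin.symm i)) (fun i => hγ _ (T.equivFin.symm i).2) ?_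
    intro i j hij
    refine Disjoint.mono (hsub _ (T.equivFin.symm i).2) (hsub _ (T.equivFin.symm j).2) ?_
    rw [Set.disjoint_left]
    rintro _ ⟨t, ht, rfl⟩ ⟨t', ht', h⟩
    exact hij (T.equivFin.symm.injective (Subtype.ext (M.arc_inj _ _ _ _ ht' ht h).1)).symm

/-- Suppose all boundary points of `A` are saturated. Then `A` contains both ends of any edge whose
interior it meets, and the fire never enters `A`: the first vertex of `A` to burn would have
out-degree exceeding `D`. So `A` has no vertex and is empty. -/
theorem isReduced_of_burnt [T2Space X] [Fintype S] [Fintype F] [DecidableEq S]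
    (M : CellModel S F X) {s₀ : S} {D : Divisor X} (hsupp : ∀ x, D x ≠ 0 → ∃ s, M.pt s = x)
    (hD : ∀ p, p ≠ M.pt s₀ → 0 ≤ D p)
    (h : Burnt M.src M.tgt s₀ (fun s => D (M.pt s)) Finset.univ) : IsReduced (M.pt s₀) D := by
  refine ⟨hD, fun A hAc hne h0 => ?_⟩
  by_contra! hsat
  replace hsat : ∀ p ∈ frontier A, (outdeg A p : ℤ) ≤ D p := hsat
  have hedge : ∀ e, ∀ t ∈ Ioo (M.lo e) (M.hi e), M.arc e t ∈ A →
      M.pt (M.src e) ∈ A ∧ M.pt (M.tgt e) ∈ A := by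
    intro e t ht htA
    have hall : ∀ y ∈ Ioo (M.lo e) (M.hi e), M.arc e y ∈ A := by
      intro y hy
      by_contra hyA
      obtain ⟨x, hx, hxf, hpos⟩ := M.exists_frontier_of_ne hAc.isClosed ht hy htA hyA
      -- Saturation with positive out-degree puts a chip in the interior of an edge, where `D` has
      -- none.
      have h1 := hsat _ hxf
      obtain ⟨s, hs⟩ := hsupp (M.arc e x) (by omega)
      exact M.arc_ne_pt e x s hx hs.symm
    have hcl : Icc (M.lo e) (M.hi e) ⊆ M.arc e ⁻¹' A := by
      rw [← closure_Ioo (M.lo_lt_hi e).ne]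
      exact closure_minimal hall (hAc.isClosed.preimage (M.continuous_arc e))
    exact ⟨M.arc_lo e ▸ hcl ⟨le_rfl, (M.lo_lt_hi e).le⟩,
      M.arc_hi e ▸ hcl ⟨(M.lo_lt_hi e).le, le_rfl⟩⟩
  have hdisj : ∀ B, Burnt M.src M.tgt s₀ (fun s => D (M.pt s)) B → ∀ b ∈ B, M.pt b ∉ A := by
    intro B hB
    induction hB with
    | base => simpa using h0
    | @step B s hB hs hlt ih =>
      intro b hb
      rcases Finset.mem_insert.mp hb with rfl | hb
      · intro hbA
        have hb0 : M.pt b ≠ M.pt s₀ := fun h => h0 (h ▸ hbA)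
        have h1 := hD _ hb0
        obtain ⟨h2, h3⟩ := M.le_outdeg_of_edgesTo hbA ih hedge (by omega)
        have h4 := hsat _ h2
        omega
      · exact ih b hb
  obtain ⟨x, hx⟩ := hne
  rcases M.cover x with ⟨s, rfl⟩ | ⟨e, t, ht, rfl⟩
  · exact hdisj _ h s (Finset.mem_univ _) hx
  · exact hdisj _ h _ (Finset.mem_univ _) (hedge e t ht hx).1

/-- If a maximal burnt set `B` misses a vertex, test reducedness on the closed subgraph spanned by
the unburnt vertices. An unsaturated boundary point is an unburnt vertex whose edges leaving the
subgraph all end in `B`, so it would burn next. -/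
theorem burnt_of_isReduced [T2Space X] [Fintype S] [Fintype F] [DecidableEq S]
    (M : CellModel S F X) {s₀ : S} {D : Divisor X} (h : IsReduced (M.pt s₀) D) :
    Burnt M.src M.tgt s₀ (fun s => D (M.pt s)) Finset.univ := by
  classical
  obtain ⟨B, hB, hmax⟩ := (Set.toFinite
    {B | Burnt M.src M.tgt s₀ (fun s => D (M.pt s)) B}).exists_maximal ⟨_, .base⟩
  rcases eq_or_ne B Finset.univ with rfl | hne
  · exact hB
  exfalso
  set A : Set X := M.pt '' {s | s ∉ B} ∪
    ⋃ e ∈ {e | M.src e ∉ B ∧ M.tgt e ∉ B}, M.arc e '' Icc (M.lo e) (M.hi e) with hA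
  have hAc : IsCompact A := ((toFinite _).isCompact).union
    ((toFinite _).isCompact_biUnion fun e _ => M.isCompact_arc_image _ _ _)
  have hpt : ∀ s, M.pt s ∈ A → s ∉ B := by
    rintro s (⟨s', hs', h⟩ | hx)
    · exact M.pt_injective h ▸ hs'
    · simp only [mem_iUnion] at hx
      obtain ⟨e, he, t, ht, h⟩ := hx
      rcases eq_endpoints_or_mem_Ioo_of_mem_Icc ht with rfl | rfl | h1
      · exact M.pt_injective ((M.arc_lo e).symm.trans h) ▸ he.1
      · exact M.pt_injective ((M.arc_hi e).symm.trans h) ▸ he.2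
      · exact absurd h (M.arc_ne_pt e t s h1)
  obtain ⟨s, hs⟩ : ∃ s, s ∉ B := by
    by_contra! hall
    exact hne (Finset.eq_univ_iff_forall.mpr hall)
  obtain ⟨p, hp, hns⟩ := h.2 A hAc ⟨M.pt s, Or.inl ⟨s, hs, rfl⟩⟩
    fun h0 => hpt _ h0 hB.mem_base
  have hpA : p ∈ A := hAc.isClosed.frontier_subset hp
  obtain ⟨v, rfl⟩ : ∃ v, M.pt v = p := by
    rcases M.cover p with h | ⟨e, t, ht, rfl⟩
    · exact h
    exfalso
    rcases hpA with ⟨s', -, h⟩ | hx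
    · exact M.arc_ne_pt e t s' ht h.symm
    simp only [mem_iUnion] at hx
    obtain ⟨e', he', u, hu, h⟩ := hx
    rcases eq_endpoints_or_mem_Ioo_of_mem_Icc hu with rfl | rfl | h1
    · exact M.arc_ne_pt e t _ ht (h.symm.trans (M.arc_lo e'))
    · exact M.arc_ne_pt e t _ ht (h.symm.trans (M.arc_hi e'))
    obtain ⟨rfl, rfl⟩ := M.arc_inj e' e u t h1 ht h
    -- A point inside an edge of `A` has the whole open edge as a neighbourhood in `A`, so it is not
    -- on the boundary.
    refine hp.2 (mem_interior.mpr ⟨M.arc e' '' Ioo (M.lo e') (M.hi e'), ?_,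
      M.isOpen_arc_image e' le_rfl le_rfl, ⟨u, ht, rfl⟩⟩)
    exact (image_mono Ioo_subset_Icc_self).trans
      ((subset_biUnion_of_mem (u := fun e => M.arc e '' Icc (M.lo e) (M.hi e)) he').trans
        subset_union_right)
  have hv := hpt v hpA
  have hle := M.outdeg_le A v (edgesTo M.src M.tgt v B) (by
    intro e he hnot
    have hnn : ¬ (M.src e ∉ B ∧ M.tgt e ∉ B) := fun hee => hnot <|
      (image_mono Ioo_subset_Icc_self).trans
        ((subset_biUnion_of_mem (s := {e | M.src e ∉ B ∧ M.tgt e ∉ B})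
          (u := fun e => M.arc e '' Icc (M.lo e) (M.hi e)) hee).trans subset_union_right)
    simp only [edgesTo, Finset.mem_filter, Finset.mem_univ, true_and]
    rcases he with rfl | rfl <;> tauto)
  have hlt : D (M.pt v) < (edgesTo M.src M.tgt v B).card := by
    have := not_le.mp hns
    omega
  exact hv (hmax (Burnt.step hB hv hlt) (Finset.subset_insert v B) (Finset.mem_insert_self v B))

/-! ### Refinement and the theorem for a cell structure. -/

/-- Any finite set of points can be made part of the vertex set. -/
theorem exists_refinement {S : Type u} {F : Type v} [Fintype S] [Fintype F] (M : CellModel S F X)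
    (T : Finset X) : ∃ (S' : Type u) (F' : Type v) (_ : Fintype S') (_ : Fintype F')
      (M' : CellModel S' F' X), (∀ x ∈ T, ∃ s, M'.pt s = x) ∧
        Fintype.card F' + Fintype.card S = Fintype.card F + Fintype.card S' := by
  classical
  induction T using Finset.induction_on with
  | empty => exact ⟨S, F, _, _, M, by simp, rfl⟩
  | insert p T _ ih =>
    obtain ⟨S', F', _, _, M', hT, hcard⟩ := ih
    rcases M'.cover p with hp | ⟨e, c, hc, rfl⟩
    · refine ⟨S', F', _, _, M', fun x hx => ?_, hcard⟩
      rcases Finset.mem_insert.mp hx with rfl | hx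
      exacts [hp, hT x hx]
    · refine ⟨Option S', Option F', inferInstance, inferInstance, M'.subdivide e c hc,
        fun x hx => ?_, ?_⟩
      · rcases Finset.mem_insert.mp hx with rfl | hx
        · exact ⟨none, rfl⟩
        · obtain ⟨s, rfl⟩ := hT x hx
          exact ⟨some s, rfl⟩
      · simp only [Fintype.card_option]
        omega

/-- The main theorem for a space with a loopless cell structure. -/
theorem exists_isReduced_add [T2Space X] [Fintype S] [Fintype F] (M : CellModel S F X)
    {v₀ : X} {D : Divisor X} (hD : IsReduced v₀ D)
    (hdeg : deg D - D v₀ + Fintype.card S ≤ Fintype.card F) :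
    ∃ w, w ≠ v₀ ∧ IsReduced v₀ (D + Finsupp.single w 1) := by
  classical
  obtain ⟨S', F', _, _, M', hT, hcard⟩ := M.exists_refinement (insert v₀ D.support)
  obtain ⟨s₀, rfl⟩ := hT v₀ (Finset.mem_insert_self _ _)
  have hsupp : ∀ x, D x ≠ 0 → ∃ s, M'.pt s = x := fun x hx =>
    hT x (Finset.mem_insert_of_mem (Finsupp.mem_support_iff.mpr hx))
  have hburn := M'.burnt_of_isReduced hD
  have hsum : deg D = ∑ s, D (M'.pt s) := by
    have h1 : D.support ⊆ Finset.univ.map ⟨M'.pt, M'.pt_injective⟩ := by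
      intro x hx
      obtain ⟨s, rfl⟩ := hsupp x (Finsupp.mem_support_iff.mp hx)
      exact Finset.mem_map_of_mem _ (Finset.mem_univ s)
    rw [deg, Finsupp.sum_of_support_subset _ h1 _ (by simp), Finset.sum_map]
    rfl
  have hwithin : edgesWithin M'.src M'.tgt Finset.univ = Finset.univ := by
    ext; simp [edgesWithin]
  obtain ⟨w, -, hw0, hw⟩ := hburn.exists_add M'.src_ne_tgt (by
    rw [hwithin, Finset.card_univ, Finset.card_univ]
    have := Finset.add_sum_erase Finset.univ (fun s => D (M'.pt s)) (Finset.mem_univ s₀)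
    omega)
  refine ⟨M'.pt w, fun h => hw0 (M'.pt_injective h), M'.isReduced_of_burnt ?_ ?_ ?_⟩
  · intro x hx
    by_cases hxw : M'.pt w = x
    · exact ⟨w, hxw⟩
    · exact hsupp x (by simpa [Finsupp.single_apply, hxw] using hx)
  · intro p hp
    have h1 := hD.1 p hp
    rw [Finsupp.add_apply, Finsupp.single_apply]
    split_ifs <;> omega
  · refine hw.congr fun s _ => ?_
    simp [Finsupp.single_apply, Pi.single_apply, M'.pt_injective.eq_iff, eq_comm]

end CellModel

/-! ### The metric graph as a cell structure, and its genus. -/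

namespace EdgeWeightedGraph

variable {V : Type u} {E : Type v}

/-- A one-piece path shows that the parametrization is 1-Lipschitz on the edge; outside, it is
constant, so it factors through the projection to the interval. -/
theorem continuous_edgePoint [Finite E] (G : EdgeWeightedGraph V E) (e : E) :
    Continuous (G.edgePoint e) := by
  have hlen := (G.len_pos e).le
  have hproj : G.edgePoint e = fun t => G.edgePoint e (projIcc 0 (G.len e) hlen t) := by
    funext t
    rcases le_total t 0 with h | h
    · rw [projIcc_of_le_left _ h]
      simp [edgePoint, not_lt.mpr h]
    rcases le_total t (G.len e) with h' | h'
    · rw [projIcc_of_mem _ ⟨h, h'⟩]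
    · rw [projIcc_of_right_le _ h']
      simp [edgePoint, G.len_pos e, not_lt.mpr h', (G.len_pos e).trans_le h']
  have hlip : LipschitzWith 1 fun t : Icc 0 (G.len e) => G.edgePoint e t := by
    refine LipschitzWith.of_dist_le_mul fun s t => ?_
    have h := (PathLength.cons e s t s.2 t.2 (.nil _)).dist_le
    simpa [Subtype.dist_eq, Real.dist_eq] using h
  rw [hproj]
  exact hlip.continuous.comp continuous_projIcc

/-- The cell structure of the metric graph in which every edge is divided into two halves. -/
noncomputable def barycentric [Finite E] (G : EdgeWeightedGraph V E) :
    CellModel (V ⊕ E) (E × Bool) G.Point where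
  pt := Sum.elim Point.vertex fun e => G.edgePoint e (G.len e / 2)
  src a := bif a.2 then Sum.inr a.1 else Sum.inl (G.src a.1)
  tgt a := bif a.2 then Sum.inl (G.tgt a.1) else Sum.inr a.1
  arc a := G.edgePoint a.1
  lo a := bif a.2 then G.len a.1 / 2 else 0
  hi a := bif a.2 then G.len a.1 else G.len a.1 / 2
  lo_lt_hi := by
    rintro ⟨e, _ | _⟩ <;> have := G.len_pos e <;> simp <;> linarith
  continuous_arc a := G.continuous_edgePoint a.1
  arc_lo := by
    rintro ⟨e, _ | _⟩
    exacts [G.edgePoint_zero e, rfl]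
  arc_hi := by
    rintro ⟨e, _ | _⟩
    exacts [rfl, G.edgePoint_len e]
  src_ne_tgt := by
    rintro ⟨e, _ | _⟩ <;> simp
  pt_injective := by
    have hmid : ∀ e, G.edgePoint e (G.len e / 2) = Point.inner e (G.len e / 2)
        (half_pos (G.len_pos e)) (half_lt_self (G.len_pos e)) := fun e => G.edgePoint_inner _ _ _ _
    rintro (a | e) (b | e') h
    · simpa using h
    · simp [hmid] at h
    · simp [hmid] at h
    · simp only [Sum.elim_inr, hmid, Point.inner.injEq] at h
      rw [h.1]
  arc_inj := by
    rintro ⟨e, i⟩ ⟨e', i'⟩ t t' ht ht' h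
    have key : ∀ (e : E) (i : Bool) (t : ℝ), t ∈ Ioo (bif i then G.len e / 2 else 0)
        (bif i then G.len e else G.len e / 2) → 0 < t ∧ t < G.len e := by
      rintro e (_ | _) t ⟨h1, h2⟩ <;> have := G.len_pos e <;> simp at h1 h2 <;>
        constructor <;> linarith
    have h1 := key e i t ht
    have h2 := key e' i' t' ht'
    rw [G.edgePoint_inner e t h1.1 h1.2, G.edgePoint_inner e' t' h2.1 h2.2,
      Point.inner.injEq] at h
    obtain ⟨rfl, rfl⟩ := h
    cases i <;> cases i' <;> simp at ht ht' ⊢ <;> linarith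
  arc_ne_pt := by
    rintro ⟨e, _ | _⟩ t s ⟨h1, h2⟩ h <;> have h3 := G.len_pos e <;> simp at h1 h2 h
    · rw [G.edgePoint_inner e t h1 (by linarith)] at h
      rcases s with a | e'
      · simp at h
      · rw [Sum.elim_inr, G.edgePoint_inner e' _ (half_pos (G.len_pos e'))
          (half_lt_self (G.len_pos e')), Point.inner.injEq] at h
        obtain ⟨rfl, rfl⟩ := h
        exact lt_irrefl _ h2
    · rw [G.edgePoint_inner e t (by linarith) h2] at h
      rcases s with a | e'
      · simp at h
      · rw [Sum.elim_inr, G.edgePoint_inner e' _ (half_pos (G.len_pos e'))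
          (half_lt_self (G.len_pos e')), Point.inner.injEq] at h
        obtain ⟨rfl, rfl⟩ := h
        exact lt_irrefl _ h1
  cover := by
    rintro (a | ⟨e, t, h0, h1⟩)
    · exact Or.inl ⟨Sum.inl a, rfl⟩
    · rw [← G.edgePoint_inner e t h0 h1]
      rcases lt_trichotomy t (G.len e / 2) with h | h | h
      · exact Or.inr ⟨(e, false), t, ⟨h0, h⟩, rfl⟩
      · exact Or.inl ⟨Sum.inr e, by rw [h]; rfl⟩
      · exact Or.inr ⟨(e, true), t, ⟨h, h1⟩, rfl⟩

/-- By connectedness, the boundaries together with a single vertex span the 0-chains, so the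
boundary map has rank at least |V| - 1; rank-nullity concludes. Only this half of Euler's formula is
needed. -/
theorem genus_add_card_le [Fintype V] [Fintype E] (G : EdgeWeightedGraph V E) :
    G.genus + Fintype.card V ≤ Fintype.card E + 1 := by
  obtain ⟨a₀⟩ := G.nonempty
  have hconn : ∀ a b : V, Finsupp.single b (1 : ℚ) - Finsupp.single a 1 ∈
      LinearMap.range G.boundary := by
    intro a b
    induction G.connected a b with
    | rel p q h =>
      obtain ⟨e, rfl, rfl⟩ := h
      exact ⟨Finsupp.single e 1, by simp [boundary]⟩
    | refl p => simp
    | symm p q _ ih => simpa using neg_mem ih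
    | trans p q r _ _ ih1 ih2 => simpa using add_mem ih1 ih2
  have htop : LinearMap.range G.boundary ⊔ Submodule.span ℚ {Finsupp.single a₀ (1 : ℚ)} = ⊤ := by
    rw [eq_top_iff, ← (Finsupp.basisSingleOne (R := ℚ) (ι := V)).span_eq, Submodule.span_le]
    rintro _ ⟨b, rfl⟩
    have := Submodule.add_mem_sup (hconn a₀ b) (Submodule.mem_span_singleton_self (R := ℚ) (Finsupp.single a₀ 1))
    simpa using this
  have h1 := G.boundary.finrank_range_add_finrank_ker
  have h2 := Submodule.finrank_add_le_finrank_add_finrank (LinearMap.range G.boundary)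
    (Submodule.span ℚ {Finsupp.single a₀ (1 : ℚ)})
  rw [htop, finrank_top] at h2
  have h3 := finrank_span_singleton (K := ℚ) (v := Finsupp.single a₀ (1 : ℚ)) (by simp)
  simp only [Module.finrank_finsupp_self] at h1 h2
  rw [genus]
  omega

end EdgeWeightedGraph

end MetricGraph

theorem theorem1p9 {V E : Type*} [Finite V] [Finite E]
    (G : MetricGraph.EdgeWeightedGraph V E) (hg : 2 ≤ G.genus)
    (v₀ : G.Point) (D : MetricGraph.Divisor G.Point) (hD : MetricGraph.IsReduced v₀ D)
    (hdeg : MetricGraph.deg D - D v₀ ≤ (G.genus : ℤ) - 1) :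
    ∃ w : G.Point, w ≠ v₀ ∧ MetricGraph.IsReduced v₀ (D + Finsupp.single w 1) := by
  have := Fintype.ofFinite V
  have := Fintype.ofFinite E
  -- Halving the edges gives 2|E| edges and |V| + |E| vertices, so the difference is |E| - |V| ≥ g -
  -- 1.
  refine G.barycentric.exists_isReduced_add hD ?_
  have := G.genus_add_card_le
  simp only [Fintype.card_sum, Fintype.card_prod, Fintype.card_bool]
  push_cast
  omega
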